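/- **Model.** A primary user (PU) sends packets in slots $t=0,1,2,\dots$, retransmitting each packet until it is received successfully; the transmissions of one packet form an ARQ window. In slot $t$ a secondary user (SU) transmits ($a_t=1$) or stays idle ($a_t=0$). Given $a_t$, the PU fails (NACK) with probability $\rho_{a_t}$, where $0\le\rho_0<\rho_1\le 1$. Independently, the SU receiver's channel falls in one of seven decoding regions $y_t\in\{1,\dots,7\}$, whose probabilities are respectively $\delta_{sp},\delta_s,\delta_p,\upsilon_s,\upsilon_p,\upsilon_{sp},\upsilon_\emptyset\ge 0$ and sum to $1$: both packets decoded; only the SU packet decoded; only the PU packet decoded; only the SU packet decodable once the PU packet is removed; only the PU packet decodable once the SU packet is removed; each decodable once the other is removed; failure. Put $D_s=\delta_s+\delta_{sp}+\upsilon_s+\upsilon_{sp}$, $D_p=\delta_p+\delta_{sp}+\upsilon_p+\upsilon_{sp}$, and let $R_s>0$ be the SU rate. The state $s_t$ of the SU chain decoding protocol lies in $\{0,1,2,\dots\}\cup\{\overset{\leftrightarrow}{K},\overset{\rightarrow}{K}\}$, with $s_0=0$. After an ACK the state becomes $0$. After a NACK it evolves as follows. From $b\ge 0$ with $a_t=1$: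 it becomes $\overset{\rightarrow}{K}$ in regions $1,3,5$, $\overset{\leftrightarrow}{K}$ in region $6$, $b+1$ in region $4$, and stays $b$ otherwise. From $\overset{\leftrightarrow}{K}$ with $a_t=1$: it becomes $\overset{\rightarrow}{K}$ in regions $1,3,5$ and does not change otherwise. From $b$ or $\overset{\leftrightarrow}{K}$ with $a_t=0$: it becomes $\overset{\rightarrow}{K}$ in regions $1,3,5,6$ and does not change otherwise. From $\overset{\rightarrow}{K}$ it does not change. The expected virtual throughput of a slot is $$v_S(a,b)=R_s[a(\delta_{sp}+\delta_s)+D_pb],\quad v_S(a,\overset{\leftrightarrow}{K})=R_s[a(D_s-\upsilon_{sp})+D_p],\quad v_S(a,\overset{\rightarrow}{K})=aR_sD_s .$$ An access policy $\mu$ selects $a_t=1$ with a probability that may depend on all past actions, ACK/NACKs and regions. Its PU throughput degradation and SU throughput are $$\nabla(\mu)=\nabla_{\max}\lim_{D\to\infty}\mathbb E\Big[\frac1D\sum_{t<D}a_t\Big],\qquad \bar T_S(\mu)=\liminf_{D\to\infty}\mathbb E\Big[\frac1D\sum_{t<D}v_S(a_t,s_t)\Big],\qquad \nabla_{\max}=\frac{\rho_1-\rho_0}{1-\rho_0},$$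 with $\liminf$ in place of $\lim$ in $\nabla(\mu)$ when the limit does not exist. Given $\nabla_{th}\in(0,1)$, a policy is optimal if it maximizes $\bar T_S(\mu)$ among all access policies with $\nabla(\mu)\le\nabla_{th}$. **Theorem 1.** Let $$\nabla_{GA}=\nabla_{\max}\,\frac{\rho_0D_p}{1-\rho_1+\rho_0D_p}$$ and suppose $0<\nabla_{th}<1$ and $\nabla_{th}\le\nabla_{GA}$. Then the stationary policy $\mu^*$ that in each slot transmits with the following probability, depending on the current state, is optimal: $$\mu^*(0)=0,\qquad \mu^*(\overset{\leftrightarrow}{K})=\mu^*(b)=1\ \ (b>0),\qquad \mu^*(\overset{\rightarrow}{K})=\frac{[1-\rho_0(1-D_p)]\nabla_{th}}{[1-\rho_0(1-D_p)]\nabla_{GA}+(\rho_1-\rho_0)(\nabla_{th}-\nabla_{GA})}\in[0,1].$$ Under $\mu^*$ the limits that define $\nabla$ and $\bar T_S$ exist, the constraint is met with equality, $\nabla(\mu^*)=\nabla_{th}$, and the genie-aided throughput is attained: $\bar T_S(\mu^*)=\varepsilon R_sD_s$ with $\varepsilon=\nabla_{th}/\nabla_{\max}$. If moreover $\rho_1<1$,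 the same degradation $\nabla_{th}$ and throughput $\varepsilon R_sD_s$ (again as limits) are achieved by randomizing between two modes: for some $\xi\in[0,1]$, at the beginning of each ARQ window the SU selects, independently, with probability $\xi$ the IC mode (idle in state $0$, transmit in every other state) and with probability $1-\xi$ the Idle mode (never transmit), and keeps that mode until the end of the window. -/

import Mathlib

open Filter Topology

/-- The seven decoding regions of the multiple access channel at the SU receiver,
which are also the values of the feedback signal of the SU receiver. -/
inductive Outcome
  | both     -- 1: both packets decoded
  | onlyS    -- 2: only the SU packet decoded
  | onlyP    -- 3: only the PU packet decoded
  | PtoS     -- 4: the SU packet is decodable once the PU packet is removed, not vice versa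
  | StoP     -- 5: the PU packet is decodable once the SU packet is removed, not vice versa
  | mutual   -- 6: each packet is decodable once the other one is removed
  | fail     -- 7: nothing can be decoded
  deriving DecidableEq

instance : Fintype Outcome where
  elems := {.both, .onlyS, .onlyP, .PtoS, .StoP, .mutual, .fail}
  complete := by intro x; cases x <;> decide

/-- What the SU transmitter learns in one slot: its own action `tx` (`true` = transmit),
the ARQ feedback of the PU receiver (`ack = true` for ACK, `false` for NACK)
and the feedback `y` of the SU receiver. -/
structure Feedback where
  tx : Bool
  ack : Bool
  y : Outcome
  deriving DecidableEq, Fintype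

/-- States of the chain decoding protocol: `U b` is the state (U, b), `Kbi` is K with a
bidirectional arrow, `Kto` is K with a unidirectional arrow. -/
inductive CDState
  | U (b : ℕ)
  | Kbi
  | Kto
  deriving DecidableEq

/-- Region in which the PU packet is decodable without interference from the SU. -/
def Outcome.puClear : Outcome → Bool
  | .both | .onlyP | .StoP | .mutual => true
  | .onlyS | .PtoS | .fail => false

/-- Update of the chain decoding state at the end of a slot. -/
def CDState.next (s : CDState) (f : Feedback) : CDState :=
  -- the PU succeeds: a new ARQ window begins
  if f.ack then .U 0 else
  match s, f.tx with
  | .U b, true =>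
    match f.y with
    | .both | .onlyP | .StoP => .Kto
    | .mutual => .Kbi
    | .PtoS => .U (b + 1)
    | .onlyS | .fail => .U b
  | .U b, false => if f.y.puClear then .Kto else .U b
  | .Kbi, true =>
    match f.y with
    | .both | .onlyP | .StoP => .Kto
    | .mutual | .PtoS | .onlyS | .fail => .Kbi
  | .Kbi, false => if f.y.puClear then .Kto else .Kbi
  | .Kto, _ => .Kto

/-- The state reached after a history of feedbacks. Histories are lists with the most recent
slot first; a new ARQ window begins in slot `0`, so the initial state is `U 0`. -/
def stateOf : List Feedback → CDState
  | [] => .U 0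
  | f :: h => (stateOf h).next f

/-- Parameters of the two-user network. -/
structure Params where
  /-- SU transmission rate -/
  Rs : ℝ
  /-- PU failure probability when the SU is idle -/
  rho0 : ℝ
  /-- PU failure probability when the SU transmits -/
  rho1 : ℝ
  /-- probabilities of the decoding regions at the SU receiver -/
  prob : Outcome → ℝ
  Rs_pos : 0 < Rs
  rho0_nonneg : 0 ≤ rho0
  rho0_lt_rho1 : rho0 < rho1
  rho1_le_one : rho1 ≤ 1
  prob_nonneg : ∀ y, 0 ≤ prob y
  prob_sum : ∑ y, prob y = 1

/-- The action as a number in {0, 1}. -/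
def act (a : Bool) : ℝ := if a then 1 else 0

namespace Params

/-- Interference-free decoding probability of the SU packet at the SU receiver. -/
def Ds (p : Params) : ℝ := p.prob .onlyS + p.prob .both + p.prob .PtoS + p.prob .mutual

/-- Interference-free decoding probability of the PU packet at the SU receiver. -/
def Dp (p : Params) : ℝ := p.prob .onlyP + p.prob .both + p.prob .StoP + p.prob .mutual

/-- PU failure probability given the action of the SU. -/
def rho (p : Params) (a : Bool) : ℝ := if a then p.rho1 else p.rho0

/-- Probability of the two feedback signals in a slot given the action in that slot. The links
fade independently, so that the two signals are independent given the action. -/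
def fbProb (p : Params) (f : Feedback) : ℝ :=
  (if f.ack then 1 - p.rho f.tx else p.rho f.tx) * p.prob f.y

/-- Transition probabilities of the chain decoding state. -/
def trans (p : Params) (a : Bool) : CDState → CDState → ℝ
  | .U b, x =>
    (if x = .U 0 then 1 - p.rho a else 0)
    + (if x = .U b then p.rho a * (1 - p.Dp - act a * p.prob .PtoS) else 0)
    + (if x = .U (b + 1) then p.rho1 * act a * p.prob .PtoS else 0)
    + (if x = .Kbi then p.rho1 * act a * p.prob .mutual else 0)
    + (if x = .Kto then p.rho a * (p.Dp - act a * p.prob .mutual) else 0)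
  | .Kbi, x =>
    (if x = .U 0 then 1 - p.rho a else 0)
    + (if x = .Kbi then p.rho a * (1 - p.Dp + act a * p.prob .mutual) else 0)
    + (if x = .Kto then p.rho a * (p.Dp - act a * p.prob .mutual) else 0)
  | .Kto, x =>
    (if x = .U 0 then 1 - p.rho a else 0) + (if x = .Kto then p.rho a else 0)

/-- Expected virtual instantaneous throughput of the SU. -/
def vS (p : Params) (a : Bool) : CDState → ℝ
  | .U b => p.Rs * (act a * (p.prob .both + p.prob .onlyS) + p.Dp * b)
  | .Kbi => p.Rs * (act a * (p.Ds - p.prob .mutual) + p.Dp)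
  | .Kto => act a * p.Rs * p.Ds

/-- Largest possible degradation of the PU throughput. -/
noncomputable def nablaMax (p : Params) : ℝ := (p.rho1 - p.rho0) / (1 - p.rho0)

/-- Degradation of the PU throughput when the SU transmits exactly when the PU packet is known:
the steady-state probability of `Kto` times the largest degradation. -/
noncomputable def nablaGA (p : Params) : ℝ :=
  p.rho0 * p.Dp / (1 - p.rho1 + p.rho0 * p.Dp) * p.nablaMax

/-- Genie-aided SU throughput with access probability `ε`. -/
def genie (p : Params) (ε : ℝ) : ℝ := ε * p.Rs * p.Ds

end Params

/-- The feedbacks induce the transition probabilities above. -/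
theorem Params.sum_fbProb_next (p : Params) (a : Bool) (s x : CDState) :
    (∑ k : Bool, ∑ y : Outcome,
      if s.next ⟨a, k, y⟩ = x then p.fbProb ⟨a, k, y⟩ else 0) = p.trans a s x := by
  have hs : ∀ g : Outcome → ℝ, ∑ y, g y = g .both + g .onlyS + g .onlyP + g .PtoS + g .StoP
      + g .mutual + g .fail := by
    intro g
    have : (Finset.univ : Finset Outcome) =
        {.both, .onlyS, .onlyP, .PtoS, .StoP, .mutual, .fail} := by decide
    rw [this]
    simp
    ring
  have h1 := p.prob_sum
  rw [hs] at h1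
  have hf : p.prob .fail = 1 - (p.prob .both + p.prob .onlyS + p.prob .onlyP + p.prob .PtoS
      + p.prob .StoP + p.prob .mutual) := by linarith
  simp only [Fintype.sum_bool, hs]
  cases s <;> cases a <;>
    simp only [CDState.next, Params.fbProb, Params.trans, Params.rho, act, Params.Dp,
      Outcome.puClear, hf, @eq_comm _ x] <;>
    simp only [if_true, if_false, Bool.false_eq_true] <;>
    split_ifs <;> ring

/-- A slot record: a private label of the SU (it makes room for policies that randomize
between modes of operation) and the feedbacks of the slot. -/
abbrev Slot (M : Type) : Type := M × Feedback

/-- A randomized controller: the probability with which, after a given history, the SU draws the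
label `m` and takes the action `a` in the next slot. -/
abbrev Controller (M : Type) : Type := List (Slot M) → M → Bool → ℝ

section Law

variable {M : Type} (p : Params) (c : Controller M)

/-- Probability that the first slots of the system follow the given history
(most recent slot first). -/
def trajProb : List (Slot M) → ℝ
  | [] => 1
  | o :: h => trajProb h * (c h o.1 o.2.tx * p.fbProb o.2)

/-- Expectation of a function of the history of the first `D` slots. -/
def expect [Fintype M] (D : ℕ) (F : List (Slot M) → ℝ) : ℝ :=
  ∑ h : Fin D → Slot M, trajProb p c (List.ofFn h) * F (List.ofFn h)

/-- Sum along a history of a function of the action and the state in each slot. -/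
def total (r : Bool → CDState → ℝ) : List (Slot M) → ℝ
  | [] => 0
  | o :: h => total r h + r o.2.tx (stateOf (h.map Prod.snd))

/-- PU throughput degradation, in expectation, over the first `D` slots. -/
noncomputable def degAvg [Fintype M] (D : ℕ) : ℝ :=
  p.nablaMax * (expect p c D (total fun a _ => act a) / D)

/-- Average (virtual) SU throughput, in expectation, over the first `D` slots. -/
noncomputable def thrAvg [Fintype M] (D : ℕ) : ℝ :=
  expect p c D (total p.vS) / D

/-- Long-term PU throughput degradation. It is the limit of `degAvg` whenever that exists; the
lower limit makes the constraint on it as weak as possible for all other policies. -/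
noncomputable def nabla [Fintype M] : ℝ := liminf (degAvg p c) atTop

/-- Long-term SU throughput. -/
noncomputable def throughput [Fintype M] : ℝ := liminf (thrAvg p c) atTop

end Law

/-- The controller of an access policy, which maps the history of all feedbacks to the probability
of transmitting in the next slot; no label is used. -/
def ofPolicy (μ : List Feedback → ℝ) : Controller Unit := fun h _ a =>
  if a then μ (h.map Prod.snd) else 1 - μ (h.map Prod.snd)

/-- Access policies: all maps from histories to transmission probabilities. -/
def IsAccessPolicy (μ : List Feedback → ℝ) : Prop := ∀ h, 0 ≤ μ h ∧ μ h ≤ 1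

/-- The access policy given by a stationary, state-dependent policy. -/
def stationary (μ : CDState → ℝ) : List Feedback → ℝ := fun h => μ (stateOf h)

/-- `μ` maximizes the SU throughput among all access policies whose PU throughput degradation is at
most `th`. -/
def IsOptimalPolicy (p : Params) (th : ℝ) (μ : List Feedback → ℝ) : Prop :=
  IsAccessPolicy μ ∧ nabla p (ofPolicy μ) ≤ th ∧
    ∀ ν : List Feedback → ℝ, IsAccessPolicy ν → nabla p (ofPolicy ν) ≤ th →
      throughput p (ofPolicy ν) ≤ throughput p (ofPolicy μ)

/-- The closed-form policy. -/
noncomputable def muStar (p : Params) (th : ℝ) : CDState → ℝ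
  | .U 0 => 0
  | .U (_ + 1) => 1
  | .Kbi => 1
  | .Kto => (1 - p.rho0 * (1 - p.Dp)) * th /
      ((1 - p.rho0 * (1 - p.Dp)) * p.nablaGA + (p.rho1 - p.rho0) * (th - p.nablaGA))

/-- Modes of operation over an ARQ window. -/
inductive Mode
  | idle
  | ic
  deriving DecidableEq

instance : Fintype Mode where
  elems := {.idle, .ic}
  complete := by intro x; cases x <;> decide

/-- Action of a mode in a state: Idle never transmits; IC stays idle in state `U 0` only. -/
def Mode.action : Mode → CDState → Bool
  | .idle, _ => false
  | .ic, s => decide (s ≠ .U 0)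

/-- Probability that the label of the next slot is `m`: at the beginning of each ARQ window
(in the first slot and after each ACK) a mode is drawn afresh, IC with probability `ξ` and Idle
otherwise; it is kept until the end of the window. -/
def modeProb (ξ : ℝ) : List (Slot Mode) → Mode → ℝ
  | [], .ic => ξ
  | [], .idle => 1 - ξ
  | o :: _, m =>
    if o.2.ack then (match m with | .ic => ξ | .idle => 1 - ξ)
    else if m = o.1 then 1 else 0

/-- The controller that randomizes between the Idle and IC modes in this way. -/
def modeController (ξ : ℝ) : Controller Mode := fun h m a =>
  if a = m.action (stateOf (h.map Prod.snd)) then modeProb ξ h m else 0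

/-! The upper bound is a potential argument. Let the potential be `Rs` times the number of buffered
SU packets. Each SU transmission is worth at most `Rs * Ds` on average: a packet is decoded at once,
buffered, or lost, and buffered packets are paid out when the PU packet is decoded or lost at an
ACK. Hence virtual throughput minus `Rs * Ds` per transmission, plus potential, is a supermartingale
(`Params.vS_drift`, `expect_total_vS_le`). For every controller the throughput is at most `Rs * Ds`
times the access rate, which the constraint limits to `th / nablaMax` (`throughput_le_genie`).

The bound is tight when nothing is ever buffered. A controller that is idle in `U 0` visits only `U
0` and `Kto`, where the virtual throughput is exactly `Rs * Ds` per transmission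
(`tendsto_degAvg_thrAvg`). It then remains to tune the access rate to `ε = th / nablaMax`, certified
by a bounded solution of the Poisson equation: for `muStar` a multiple of the indicator of `Kto`,
for the mode controller the future reward within the window. The condition `th ≤ nablaGA` says that
the parameter so obtained lies in `[0, 1]`. -/

section Law

variable {M : Type} {p : Params} {c : Controller M}

/-- A controller that is idle in state `U 0` only visits `U 0` and `Kto`. -/
theorem stateOf_of_trajProb_ne_zero
    (hidle : ∀ h m, stateOf (h.map Prod.snd) = .U 0 → c h m true = 0) :
    ∀ h, trajProb p c h ≠ 0 →
      stateOf (h.map Prod.snd) = .U 0 ∨ stateOf (h.map Prod.snd) = .Kto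
  | [], _ => Or.inl rfl
  | ⟨m, a, k, y⟩ :: h, h0 => by
    simp only [trajProb] at h0
    have h1 := left_ne_zero_of_mul h0
    have h2 := left_ne_zero_of_mul (right_ne_zero_of_mul h0)
    rcases stateOf_of_trajProb_ne_zero hidle h h1 with h3 | h3
    · cases a
      · cases k <;> cases y <;> simp [stateOf, h3, CDState.next, Outcome.puClear]
      · exact absurd (hidle h m h3) h2
    · cases k <;> simp [stateOf, h3, CDState.next]

/-! ### Expectations over histories and one-slot conditioning. -/

variable [Fintype M]

/-- Conditional expectation of `F`, one slot later, given the history `h`. -/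
def step (p : Params) (c : Controller M) (F : List (Slot M) → ℝ) (h : List (Slot M)) : ℝ :=
  ∑ o : Slot M, c h o.1 o.2.tx * p.fbProb o.2 * F (o :: h)

/-- The controller prescribes a probability distribution after every history. -/
structure IsStochastic (c : Controller M) : Prop where
  nonneg : ∀ h m a, 0 ≤ c h m a
  sum_eq_one : ∀ h, ∑ m, ∑ a, c h m a = 1

theorem expect_zero (F : List (Slot M) → ℝ) : expect p c 0 F = F [] := by
  simp [expect, trajProb]

/-- Tower property: the most recent slot is the head of the list, so its conditional law factors out
of `trajProb`. -/
theorem expect_succ (D : ℕ) (F : List (Slot M) → ℝ) :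
    expect p c (D + 1) F = expect p c D (step p c F) := by
  unfold expect step
  rw [← (Fin.consEquiv fun _ : Fin (D + 1) => Slot M).sum_comp, Fintype.sum_prod_type_right]
  refine Finset.sum_congr rfl fun h _ => ?_
  rw [Finset.mul_sum]
  refine Finset.sum_congr rfl fun o _ => ?_
  simp only [Fin.consEquiv_apply, List.ofFn_succ, Fin.cons_zero, Fin.cons_succ, trajProb]
  ring

theorem expect_add (D : ℕ) (F G : List (Slot M) → ℝ) :
    expect p c D (fun h => F h + G h) = expect p c D F + expect p c D G := by
  simp only [expect, mul_add, Finset.sum_add_distrib]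

theorem expect_const_mul (D : ℕ) (a : ℝ) (F : List (Slot M) → ℝ) :
    expect p c D (fun h => a * F h) = a * expect p c D F := by
  simp only [expect, Finset.mul_sum]
  exact Finset.sum_congr rfl fun _ _ => by ring

theorem expect_congr {D : ℕ} {F G : List (Slot M) → ℝ}
    (hFG : ∀ h, trajProb p c h ≠ 0 → F h = G h) : expect p c D F = expect p c D G := by
  refine Finset.sum_congr rfl fun h _ => ?_
  by_cases h0 : trajProb p c (List.ofFn h) = 0
  · simp [h0]
  · rw [hFG _ h0]

theorem Params.rho_nonneg (p : Params) (a : Bool) : 0 ≤ p.rho a := by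
  have h0 := p.rho0_nonneg
  have h1 := p.rho0_lt_rho1
  cases a
  · simpa [Params.rho] using h0
  · simpa [Params.rho] using h0.trans h1.le

theorem Params.rho_le_one (p : Params) (a : Bool) : p.rho a ≤ 1 := by
  have h0 := p.rho1_le_one
  have h1 := p.rho0_lt_rho1
  cases a
  · simpa [Params.rho] using h1.le.trans h0
  · simpa [Params.rho] using h0

theorem Params.fbProb_nonneg (p : Params) (f : Feedback) : 0 ≤ p.fbProb f := by
  unfold Params.fbProb
  refine mul_nonneg ?_ (p.prob_nonneg _)
  split_ifs
  · linarith [p.rho_le_one f.tx]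
  · exact p.rho_nonneg f.tx

theorem trajProb_nonneg (hc : IsStochastic c) : ∀ h, 0 ≤ trajProb p c h
  | [] => by simp [trajProb]
  | o :: h => mul_nonneg (trajProb_nonneg hc h)
      (mul_nonneg (hc.nonneg _ _ _) (p.fbProb_nonneg _))

theorem expect_mono (hc : IsStochastic c) (D : ℕ) {F G : List (Slot M) → ℝ}
    (hFG : ∀ h, F h ≤ G h) : expect p c D F ≤ expect p c D G :=
  Finset.sum_le_sum fun _ _ => mul_le_mul_of_nonneg_left (hFG _) (trajProb_nonneg hc _)

theorem sum_feedback (g : Feedback → ℝ) :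
    ∑ f, g f = ∑ a : Bool, ∑ k : Bool, ∑ y : Outcome, g ⟨a, k, y⟩ := by
  let e : Bool × Bool × Outcome ≃ Feedback :=
    { toFun := fun x => ⟨x.1, x.2.1, x.2.2⟩
      invFun := fun f => (f.tx, f.ack, f.y)
      left_inv := fun _ => rfl
      right_inv := fun _ => rfl }
  rw [← e.sum_comp, Fintype.sum_prod_type]
  refine Finset.sum_congr rfl fun a _ => ?_
  rw [Fintype.sum_prod_type]
  rfl

theorem sum_outcome (g : Outcome → ℝ) :
    ∑ y, g y = g .both + g .onlyS + g .onlyP + g .PtoS + g .StoP + g .mutual + g .fail := by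
  have : (Finset.univ : Finset Outcome) =
      {.both, .onlyS, .onlyP, .PtoS, .StoP, .mutual, .fail} := by decide
  rw [this]
  simp
  ring

/-- Expectation over the feedback signals of one slot, given the action. -/
def Params.mean (p : Params) (a : Bool) (G : Feedback → ℝ) : ℝ :=
  (1 - p.rho a) * ∑ y, p.prob y * G ⟨a, true, y⟩ + p.rho a * ∑ y, p.prob y * G ⟨a, false, y⟩

theorem step_eq (F : List (Slot M) → ℝ) (h : List (Slot M)) :
    step p c F h = ∑ m, ∑ a, c h m a * p.mean a fun f => F ((m, f) :: h) := by
  unfold step Params.mean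
  rw [Fintype.sum_prod_type]
  refine Finset.sum_congr rfl fun m _ => ?_
  rw [sum_feedback]
  refine Finset.sum_congr rfl fun a _ => ?_
  simp only [Fintype.sum_bool, Params.fbProb, Finset.mul_sum, mul_add, if_true,
    Bool.false_eq_true, if_false, mul_assoc]

theorem Params.mean_const (p : Params) (a : Bool) (x : ℝ) : (p.mean a fun _ => x) = x := by
  simp only [Params.mean, ← Finset.sum_mul, p.prob_sum]
  ring

theorem Params.mean_add (p : Params) (a : Bool) (F G : Feedback → ℝ) :
    (p.mean a fun f => F f + G f) = p.mean a F + p.mean a G := by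
  simp only [Params.mean, mul_add, Finset.sum_add_distrib]
  ring

theorem step_const (hc : IsStochastic c) (x : ℝ) (h : List (Slot M)) :
    step p c (fun _ => x) h = x := by
  rw [step_eq]
  simp only [Params.mean_const, ← Finset.sum_mul, hc.sum_eq_one, one_mul]

theorem expect_const (hc : IsStochastic c) (x : ℝ) (D : ℕ) : expect p c D (fun _ => x) = x := by
  induction D with
  | zero => exact expect_zero _
  | succ D ih => rw [expect_succ, funext (step_const hc x), ih]

/-! ### Supermartingales, the Poisson equation and long-run averages. -/

theorem expect_le_of_step_le (hc : IsStochastic c) {F : List (Slot M) → ℝ}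
    (hF : ∀ h, step p c F h ≤ F h) (D : ℕ) : expect p c D F ≤ F [] := by
  induction D with
  | zero => exact (expect_zero _).le
  | succ D ih =>
    rw [expect_succ]
    exact (expect_mono hc D hF).trans ih

/-- Slot-wise reward plus a potential: the expected total reward satisfies the Poisson equation. -/
theorem expect_total_of_poisson (hc : IsStochastic c) {r : Bool → CDState → ℝ}
    {W : List (Slot M) → ℝ} {g : ℝ}
    (hW : ∀ h, trajProb p c h ≠ 0 →
      ∑ m, ∑ a, c h m a * (r a (stateOf (h.map Prod.snd)) + p.mean a fun f => W ((m, f) :: h))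
        = g + W h) (D : ℕ) :
    expect p c D (total r) + expect p c D W = g * D + W [] := by
  rw [← expect_add]
  induction D with
  | zero => simp [expect_zero, total]
  | succ D ih =>
    have hs : ∀ h, trajProb p c h ≠ 0 →
        step p c (fun h => total r h + W h) h = g + (total r h + W h) := by
      intro h h0
      have h1 := hW h h0
      have h2 := hc.sum_eq_one h
      rw [step_eq]
      have h3 : ∀ m a, (p.mean a fun f => total r ((m, f) :: h) + W ((m, f) :: h)) =
          total r h + (r a (stateOf (h.map Prod.snd)) + p.mean a fun f => W ((m, f) :: h)) := by
        intro m a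
        rw [Params.mean_add, ← add_assoc]
        congr 1
        -- Everything accumulated up to the current action is constant given `h` and `a`, so it can
        -- be moved inside the mean.
        rw [← p.mean_const a (total r h + _)]
        simp only [Params.mean, total]
      simp only [h3, mul_add (c h _ _) (total r h), Finset.sum_add_distrib]
      rw [h1]
      simp only [← Finset.sum_mul, h2]
      ring
    rw [expect_succ, expect_congr hs, expect_add, ih, expect_const hc]
    push_cast
    ring

/-- The Poisson equation telescopes, so the expected total differs from `g * D` by at most `2 * C`,
which vanishes after division by `D`. -/
theorem tendsto_expect_total_div (hc : IsStochastic c) {r : Bool → CDState → ℝ}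
    {W : List (Slot M) → ℝ} {g C : ℝ} (hC : ∀ h, |W h| ≤ C)
    (hW : ∀ h, trajProb p c h ≠ 0 →
      ∑ m, ∑ a, c h m a * (r a (stateOf (h.map Prod.snd)) + p.mean a fun f => W ((m, f) :: h))
        = g + W h) :
    Tendsto (fun D : ℕ => expect p c D (total r) / D) atTop (𝓝 g) := by
  have hb : ∀ D : ℕ, |W [] - expect p c D W| ≤ 2 * C := by
    intro D
    have h1 : expect p c D W ≤ C :=
      (expect_mono hc D fun h => (abs_le.1 (hC h)).2).trans (expect_const hc C D).le
    have h2 : -C ≤ expect p c D W :=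
      (expect_const hc (-C) D).ge.trans (expect_mono hc D fun h => (abs_le.1 (hC h)).1)
    have h3 := abs_le.1 (hC [])
    rw [abs_le]
    constructor <;> linarith [h3.1, h3.2]
  have h0 : Tendsto (fun D : ℕ => (W [] - expect p c D W) / (D : ℝ)) atTop (𝓝 0) := by
    refine squeeze_zero_norm (a := fun D : ℕ => 2 * C / (D : ℝ)) (fun D => ?_)
      (tendsto_const_div_atTop_nhds_zero_nat _)
    rw [Real.norm_eq_abs, abs_div, Nat.abs_cast]
    exact div_le_div_of_nonneg_right (hb D) (Nat.cast_nonneg D)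
  have h1 := h0.const_add g
  rw [add_zero] at h1
  refine h1.congr' ?_
  filter_upwards [eventually_gt_atTop 0] with D hD
  have hD' : (D : ℝ) ≠ 0 := by positivity
  have := expect_total_of_poisson hc hW D
  field_simp
  linarith

/-- Long-term averages of a controller that is idle in state `U 0`. -/
theorem tendsto_degAvg_thrAvg (hc : IsStochastic c)
    (hidle : ∀ h m, stateOf (h.map Prod.snd) = .U 0 → c h m true = 0)
    {W : List (Slot M) → ℝ} {g C : ℝ} (hC : ∀ h, |W h| ≤ C)
    (hW : ∀ h, stateOf (h.map Prod.snd) = .U 0 ∨ stateOf (h.map Prod.snd) = .Kto →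
      ∑ m, ∑ a, c h m a * (act a + p.mean a fun f => W ((m, f) :: h)) = g + W h) :
    Tendsto (degAvg p c) atTop (𝓝 (p.nablaMax * g)) ∧
    Tendsto (thrAvg p c) atTop (𝓝 (p.genie g)) := by
  have hreach := stateOf_of_trajProb_ne_zero (p := p) hidle
  have hact := tendsto_expect_total_div (r := fun a _ => act a) hc hC fun h h0 => hW h (hreach h h0)
  refine ⟨hact.const_mul _, ?_⟩
  -- Proved history by history: in `U 0` the buffer is empty and the slot idle, so both rewards
  -- vanish; in `Kto` they agree by definition.
  have key : ∀ D, expect p c D (total p.vS) =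
      p.Rs * p.Ds * expect p c D (total fun a _ => act a) := by
    intro D
    rw [← expect_const_mul]
    refine expect_congr fun h => ?_
    induction h with
    | nil => simp [total]
    | cons o h ih =>
      intro h0
      simp only [trajProb] at h0
      have h1 := left_ne_zero_of_mul h0
      have h2 := left_ne_zero_of_mul (right_ne_zero_of_mul h0)
      simp only [total, ih h1, mul_add]
      congr 1
      rcases hreach h h1 with h3 | h3
      · have : o.2.tx = false := by
          by_contra h4
          rw [Bool.not_eq_false] at h4
          exact h2 (h4 ▸ hidle h o.1 h3)
        simp [h3, this, Params.vS, act]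
      · simp only [h3, Params.vS]
        ring
  have h1 := hact.const_mul (p.Rs * p.Ds)
  have h2 : p.genie g = p.Rs * p.Ds * g := by
    unfold Params.genie
    ring
  rw [h2]
  refine h1.congr fun D => ?_
  rw [thrAvg, key, mul_div_assoc]

end Law

/-! ### Upper bound by the genie-aided throughput. -/

/-- Number of SU packets that become decodable once the current PU packet is decoded. -/
def CDState.buffered : CDState → ℝ
  | .U b => b
  | .Kbi => 1
  | .Kto => 0

theorem CDState.buffered_nonneg (s : CDState) : 0 ≤ s.buffered := by
  cases s <;> simp [CDState.buffered]

theorem Params.Dp_nonneg (p : Params) : 0 ≤ p.Dp := by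
  have h := p.prob_nonneg
  unfold Params.Dp
  linarith [h .onlyP, h .both, h .StoP, h .mutual]

theorem Params.Ds_nonneg (p : Params) : 0 ≤ p.Ds := by
  have h := p.prob_nonneg
  unfold Params.Ds
  linarith [h .onlyS, h .both, h .PtoS, h .mutual]

theorem Params.Dp_le_one (p : Params) : p.Dp ≤ 1 := by
  have h := p.prob_nonneg
  have h1 := p.prob_sum
  rw [sum_outcome] at h1
  unfold Params.Dp
  linarith [h .onlyS, h .PtoS, h .fail]

/-- Expected gain over the genie-aided throughput in a slot, buffered packets included, is
nonpositive. -/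
theorem Params.vS_drift (p : Params) (a : Bool) (s : CDState) :
    p.vS a s - p.Rs * p.Ds * act a + (p.mean a fun f => p.Rs * (s.next f).buffered)
      ≤ p.Rs * s.buffered := by
  have hsum := p.prob_sum
  rw [sum_outcome] at hsum
  have hDp := p.Dp_le_one
  have hr := p.rho_le_one a
  have hP := p.prob_nonneg .PtoS
  have hM := p.prob_nonneg .mutual
  have hf : p.prob .fail = 1 - (p.prob .both + p.prob .onlyS + p.prob .onlyP + p.prob .PtoS
      + p.prob .StoP + p.prob .mutual) := by linarith
  have hRs := p.Rs_pos.le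
  cases s with
  | U b =>
    -- The exact slack: at an ACK the SU loses the newly bufferable packet and, if the PU packet was
    -- not decoded, the `b` old ones.
    have h1 : 0 ≤ p.Rs * ((1 - p.rho a) *
        (act a * (p.prob .PtoS + p.prob .mutual) + (1 - p.Dp) * b)) := by
      refine mul_nonneg hRs (mul_nonneg (by linarith) (add_nonneg ?_ ?_))
      · refine mul_nonneg ?_ (by linarith)
        cases a <;> simp [act]
      · exact mul_nonneg (by linarith) b.cast_nonneg
    refine le_of_sub_nonneg (h1.trans_eq ?_)
    cases a <;>
      simp [CDState.next, CDState.buffered, Params.mean, sum_outcome, Params.vS, act, Params.Ds,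
        Params.Dp, Outcome.puClear, hf] <;> ring
  | Kbi =>
    have h1 : 0 ≤ p.Rs * ((1 - p.rho a) * (act a * p.prob .mutual + (1 - p.Dp))) := by
      refine mul_nonneg hRs (mul_nonneg (by linarith) (add_nonneg ?_ (by linarith)))
      refine mul_nonneg ?_ hM
      cases a <;> simp [act]
    refine le_of_sub_nonneg (h1.trans_eq ?_)
    cases a <;>
      simp [CDState.next, CDState.buffered, Params.mean, sum_outcome, Params.vS, act, Params.Ds,
        Params.Dp, Outcome.puClear, hf] <;> ring
  | Kto =>
    refine le_of_eq ?_
    simp [CDState.next, CDState.buffered, Params.mean, Params.vS]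
    ring

/-- The gain over the genie plus the buffer value `W` is a supermartingale started at `0`, and `W`
is nonnegative. -/
theorem expect_total_vS_le {M : Type} [Fintype M] (p : Params) {c : Controller M}
    (hc : IsStochastic c) (D : ℕ) :
    expect p c D (total p.vS) ≤ p.Rs * p.Ds * expect p c D (total fun a _ => act a) := by
  let W : List (Slot M) → ℝ := fun h => p.Rs * (stateOf (h.map Prod.snd)).buffered
  let F : List (Slot M) → ℝ := fun h =>
    total p.vS h + (-(p.Rs * p.Ds) * total (fun a _ => act a) h + W h)
  have hF : ∀ h, step p c F h ≤ F h := by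
    intro h
    rw [step_eq]
    have h1 : ∀ m a, (p.mean a fun f => F ((m, f) :: h)) ≤ F h := by
      intro m a
      have h2 := p.vS_drift a (stateOf (h.map Prod.snd))
      let s := stateOf (h.map Prod.snd)
      let x := total p.vS h - p.Rs * p.Ds * total (fun a _ => act a) h
        + (p.vS a s - p.Rs * p.Ds * act a)
      have h3 : (p.mean a fun f => F ((m, f) :: h)) =
          p.mean a fun f => x + p.Rs * (s.next f).buffered := by
        simp only [Params.mean, F, x, total, W, List.map_cons, stateOf, s]
        congr 2 <;> refine Finset.sum_congr rfl fun y _ => ?_ <;> ring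
      rw [h3, Params.mean_add, Params.mean_const]
      simp only [F, W, x, s]
      linarith
    calc ∑ m, ∑ a, c h m a * (p.mean a fun f => F ((m, f) :: h))
        ≤ ∑ m, ∑ a, c h m a * F h := Finset.sum_le_sum fun m _ => Finset.sum_le_sum fun a _ =>
          mul_le_mul_of_nonneg_left (h1 m a) (hc.nonneg _ _ _)
      _ = F h := by simp only [← Finset.sum_mul, hc.sum_eq_one, one_mul]
  have h1 := expect_le_of_step_le hc hF D
  have h2 : F [] = 0 := by simp [F, W, total, stateOf, CDState.buffered]
  have h3 : 0 ≤ expect p c D W :=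
    (expect_const hc 0 D).ge.trans (expect_mono hc D fun h =>
      mul_nonneg p.Rs_pos.le (CDState.buffered_nonneg _))
  simp only [F] at h1 h2
  rw [expect_add, expect_add, expect_const_mul] at h1
  linarith

theorem Params.vS_nonneg (p : Params) (a : Bool) (s : CDState) : 0 ≤ p.vS a s := by
  have h := p.prob_nonneg
  have hR := p.Rs_pos.le
  have hp := p.Dp_nonneg
  have hs := p.Ds_nonneg
  have ha : 0 ≤ act a := by cases a <;> simp [act]
  cases s with
  | U b =>
    exact mul_nonneg hR (add_nonneg (mul_nonneg ha (add_nonneg (h _) (h _)))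
      (mul_nonneg hp b.cast_nonneg))
  | Kbi =>
    refine mul_nonneg hR (add_nonneg (mul_nonneg ha ?_) hp)
    unfold Params.Ds
    linarith [h .onlyS, h .both, h .PtoS]
  | Kto => exact mul_nonneg (mul_nonneg ha hR) hs

theorem total_nonneg {M : Type} {r : Bool → CDState → ℝ} (hr : ∀ a s, 0 ≤ r a s) :
    ∀ h : List (Slot M), 0 ≤ total r h
  | [] => le_rfl
  | _ :: h => add_nonneg (total_nonneg hr h) (hr _ _)

theorem thrAvg_nonneg {M : Type} [Fintype M] (p : Params) {c : Controller M}
    (hc : IsStochastic c) (D : ℕ) : 0 ≤ thrAvg p c D :=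
  div_nonneg ((expect_const hc 0 D).ge.trans (expect_mono hc D (total_nonneg p.vS_nonneg)))
    D.cast_nonneg

theorem total_act_le {M : Type} :
    ∀ h : List (Slot M), total (fun a _ => act a) h ≤ h.length
  | [] => by simp [total]
  | o :: h => by
    have h1 : act o.2.tx ≤ 1 := by cases o.2.tx <;> simp [act]
    have := total_act_le h
    simp only [total, List.length_cons]
    push_cast
    linarith

theorem expect_total_act_le {M : Type} [Fintype M] (p : Params) {c : Controller M}
    (hc : IsStochastic c) (D : ℕ) : expect p c D (total fun a _ => act a) ≤ D := by
  refine le_trans ?_ (expect_const (p := p) hc (D : ℝ) D).le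
  -- The bound holds only for histories of length `D`, so `expect_mono` does not apply.
  refine Finset.sum_le_sum fun h _ => mul_le_mul_of_nonneg_left ?_ (trajProb_nonneg hc _)
  simpa using total_act_le (List.ofFn h)

theorem Params.nablaMax_pos (p : Params) : 0 < p.nablaMax :=
  div_pos (by linarith [p.rho0_lt_rho1]) (by linarith [p.rho0_lt_rho1, p.rho1_le_one])

/-- No controller beats the genie-aided throughput at the degradation that it causes. -/
theorem throughput_le_genie {M : Type} [Fintype M] (p : Params) {c : Controller M}
    (hc : IsStochastic c) {th : ℝ} (h : nabla p c ≤ th) :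
    throughput p c ≤ p.genie (th / p.nablaMax) := by
  have hM := p.nablaMax_pos
  set K := p.Rs * p.Ds / p.nablaMax with hK
  have hK0 : 0 ≤ K := div_nonneg (mul_nonneg p.Rs_pos.le p.Ds_nonneg) hM.le
  have hle : ∀ D, thrAvg p c D ≤ K * degAvg p c D := by
    intro D
    have h1 := div_le_div_of_nonneg_right (expect_total_vS_le p hc D) (D.cast_nonneg (α := ℝ))
    refine h1.trans_eq ?_
    rw [degAvg, hK]
    field_simp
  have hdeg : ∀ D, degAvg p c D ≤ p.nablaMax := by
    intro D
    refine mul_le_of_le_one_right hM.le ?_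
    exact div_le_one_of_le₀ (expect_total_act_le p hc D) D.cast_nonneg
  have hgen : p.genie (th / p.nablaMax) = K * th := by
    rw [Params.genie, hK]
    ring
  rw [hgen]
  refine le_of_forall_pos_le_add fun e he => ?_
  -- Dividing by `K + 1` avoids a case distinction, since `K` may be `0`.
  have hlt : liminf (degAvg p c) atTop < th + e / (K + 1) :=
    lt_of_le_of_lt h (by have : 0 < e / (K + 1) := by positivity
                         linarith)
  -- A lower limit gives small degradation only infinitely often, which suffices to bound the lower
  -- limit of the throughput. Real-valued lower limits need the boundedness side conditions.
  have hfreq := frequently_lt_of_liminf_lt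
    (isBoundedUnder_of ⟨p.nablaMax, hdeg⟩ : IsBoundedUnder (· ≤ ·) atTop _).isCoboundedUnder_ge hlt
  refine liminf_le_of_frequently_le (hfreq.mono fun D hD => ?_)
    (isBoundedUnder_of ⟨0, thrAvg_nonneg p hc⟩)
  have h2 : K * (e / (K + 1)) ≤ e := by
    rw [mul_div_assoc', div_le_iff₀ (by positivity)]
    nlinarith
  have h3 := mul_le_mul_of_nonneg_left hD.le hK0
  linarith [hle D]

/-! ### Achievability by the closed-form policy. -/

theorem isStochastic_ofPolicy {μ : List Feedback → ℝ} (hμ : IsAccessPolicy μ) :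
    IsStochastic (ofPolicy μ) where
  nonneg h m a := by
    have := hμ (h.map Prod.snd)
    cases a <;> simp [ofPolicy, this.1, this.2]
  sum_eq_one h := by simp [ofPolicy]

/-- In state `U 0`, an idle slot leads to `Kto` when there is a NACK and the PU packet is decoded. -/
theorem Params.mean_idle (p : Params) (u v w : ℝ) :
    (p.mean false fun f => if f.ack then u else if f.y.puClear then v else w) =
      (1 - p.rho0) * u + p.rho0 * (p.Dp * v + (1 - p.Dp) * w) := by
  have hsum := p.prob_sum
  rw [sum_outcome] at hsum
  have hf : p.prob .fail = 1 - (p.prob .both + p.prob .onlyS + p.prob .onlyP + p.prob .PtoS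
      + p.prob .StoP + p.prob .mutual) := by linarith
  simp [Params.mean, sum_outcome, Params.rho, Params.Dp, Outcome.puClear, hf]
  ring

theorem Params.mean_ack (p : Params) (a : Bool) (u v : ℝ) :
    (p.mean a fun f => if f.ack then u else v) = (1 - p.rho a) * u + p.rho a * v := by
  simp [Params.mean, ← Finset.sum_mul, p.prob_sum]

theorem CDState.next_U_zero_idle (f : Feedback) (hf : f.tx = false) :
    (CDState.U 0).next f = if f.ack then .U 0 else if f.y.puClear then .Kto else .U 0 := by
  simp [CDState.next, hf]

theorem CDState.next_Kto (f : Feedback) :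
    CDState.Kto.next f = if f.ack then .U 0 else .Kto := by
  simp [CDState.next]

theorem Params.mean_congr (p : Params) {a : Bool} {F G : Feedback → ℝ}
    (h : ∀ f, f.tx = a → F f = G f) : p.mean a F = p.mean a G := by
  simp only [Params.mean, h ⟨a, _, _⟩ rfl]

section Feasible

variable {p : Params} {th : ℝ}

/-- Otherwise `nablaGA` would be `0`. This keeps the later denominators positive, even when `rho1 =
1`. -/
theorem Params.rho0_mul_Dp_pos (hth0 : 0 < th) (hth : th ≤ p.nablaGA) : 0 < p.rho0 * p.Dp := by
  refine lt_of_le_of_ne (mul_nonneg p.rho0_nonneg p.Dp_nonneg) fun h => ?_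
  rw [Params.nablaGA, ← h] at hth
  simp at hth
  linarith

theorem Params.div_nablaMax_le (hth : th ≤ p.nablaGA) :
    th / p.nablaMax ≤ p.rho0 * p.Dp / (1 - p.rho1 + p.rho0 * p.Dp) :=
  (div_le_iff₀ p.nablaMax_pos).2 hth

/-- The access probability in state `Kto`, in terms of the overall access rate. -/
theorem muStar_Kto (hth0 : 0 < th) (hth : th ≤ p.nablaGA) :
    muStar p th .Kto = (1 - p.rho0 * (1 - p.Dp)) * (th / p.nablaMax) /
      (p.rho0 * p.Dp + (p.rho1 - p.rho0) * (th / p.nablaMax)) := by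
  have hα := Params.rho0_mul_Dp_pos hth0 hth
  have hM := p.nablaMax_pos
  have h1 := p.rho1_le_one
  have hG : p.nablaGA * (1 - p.rho1 + p.rho0 * p.Dp) = p.rho0 * p.Dp * p.nablaMax := by
    rw [Params.nablaGA]
    have : 1 - p.rho1 + p.rho0 * p.Dp ≠ 0 := by linarith
    field_simp
  have hden : (1 - p.rho0 * (1 - p.Dp)) * p.nablaGA + (p.rho1 - p.rho0) * (th - p.nablaGA) =
      p.nablaMax * (p.rho0 * p.Dp + (p.rho1 - p.rho0) * (th / p.nablaMax)) := by
    linear_combination hG - (p.rho1 - p.rho0) * mul_div_cancel₀ th hM.ne'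
  rw [muStar, hden, ← div_div, mul_div_assoc]

/-- The upper bound rearranges to `ε * (1 - rho1 + rho0 * Dp) ≤ rho0 * Dp`, which is `th ≤ nablaGA`.
-/
theorem muStar_Kto_mem (hth0 : 0 < th) (hth : th ≤ p.nablaGA) :
    0 ≤ muStar p th .Kto ∧ muStar p th .Kto ≤ 1 := by
  have hα := Params.rho0_mul_Dp_pos hth0 hth
  have hε : 0 < th / p.nablaMax := div_pos hth0 p.nablaMax_pos
  have hle := Params.div_nablaMax_le hth
  have h1 := p.rho1_le_one
  have h2 := p.rho0_lt_rho1
  rw [le_div_iff₀ (by linarith)] at hle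
  rw [muStar_Kto hth0 hth]
  have hden : 0 < p.rho0 * p.Dp + (p.rho1 - p.rho0) * (th / p.nablaMax) :=
    add_pos hα (mul_pos (by linarith) hε)
  constructor
  · refine div_nonneg (mul_nonneg ?_ hε.le) hden.le
    linarith
  · rw [div_le_one hden]
    linarith

theorem isAccessPolicy_muStar (hth0 : 0 < th) (hth : th ≤ p.nablaGA) :
    IsAccessPolicy (stationary (muStar p th)) := by
  intro h
  unfold stationary
  rcases stateOf h with (_ | b) | _ | _
  · simp [muStar]
  · simp [muStar]
  · simp [muStar]
  · exact muStar_Kto_mem hth0 hth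

theorem tendsto_muStar (hth0 : 0 < th) (hth : th ≤ p.nablaGA) :
    Tendsto (degAvg p (ofPolicy (stationary (muStar p th)))) atTop (𝓝 th) ∧
    Tendsto (thrAvg p (ofPolicy (stationary (muStar p th)))) atTop
      (𝓝 (p.genie (th / p.nablaMax))) := by
  have hα := Params.rho0_mul_Dp_pos hth0 hth
  have hM := p.nablaMax_pos
  have hε : 0 < th / p.nablaMax := div_pos hth0 hM
  have h2 := p.rho0_lt_rho1
  have hK := muStar_Kto hth0 hth
  have hden : 0 < p.rho0 * p.Dp + (p.rho1 - p.rho0) * (th / p.nablaMax) :=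
    add_pos hα (mul_pos (by linarith) hε)
  rw [eq_div_iff hden.ne'] at hK
  have hstoch := isStochastic_ofPolicy (isAccessPolicy_muStar hth0 hth)
  set ε := th / p.nablaMax with hεdef
  have hthe : p.nablaMax * ε = th := mul_div_cancel₀ _ hM.ne'
  -- With potential `κ` on `Kto` and `0` elsewhere, the Poisson equation at `U 0` reads `rho0 * Dp *
  -- κ = ε`.
  set κ := ε / (p.rho0 * p.Dp) with hκ
  have hκα : p.rho0 * p.Dp * κ = ε := mul_div_cancel₀ _ hα.ne'
  have hκ0 : 0 ≤ κ := (div_pos hε hα).le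
  have := tendsto_degAvg_thrAvg (p := p) (g := ε) (C := κ)
    (W := fun h => if stateOf (h.map Prod.snd) = .Kto then κ else 0) hstoch ?_ ?_ ?_
  · rwa [hthe] at this
  · intro h m hs
    simp [ofPolicy, stationary, hs, muStar]
  · intro h
    split_ifs
    · exact (abs_of_nonneg hκ0).le
    · simpa using hκ0
  · intro h hs
    rcases hs with hs | hs
    · have e1 : (p.mean false fun f => if (CDState.U 0).next f = .Kto then κ else 0) =
          p.mean false fun f => if f.ack then 0 else if f.y.puClear then κ else 0 := by
        refine p.mean_congr fun f hf => ?_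
        rw [CDState.next_U_zero_idle f hf]
        split_ifs <;> simp_all
      simp [ofPolicy, stationary, hs, muStar, act, stateOf, e1, Params.mean_idle, ← hκα]
      ring
    · have e1 : ∀ a, (p.mean a fun f => if CDState.Kto.next f = .Kto then κ else 0) =
          p.rho a * κ := by
        intro a
        rw [← zero_add (p.rho a * κ), ← mul_zero (1 - p.rho a), ← p.mean_ack]
        refine p.mean_congr fun f _ => ?_
        rw [CDState.next_Kto]
        split_ifs <;> simp_all
      simp [ofPolicy, stationary, hs, act, stateOf, e1, Params.rho]
      -- Multiplied by `rho0 * Dp`, the Poisson equation at `Kto` becomes the equation `hK` for the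
      -- access probability.
      refine mul_left_cancel₀ hα.ne' ?_
      linear_combination hK + (muStar p th .Kto * (p.rho1 - p.rho0) - 1 + p.rho0) * hκα

/-! ### Achievability by randomizing between modes. -/

/-- Future reward, relative to the average `ε`, until the end of the current ARQ window. -/
noncomputable def Mode.bias (p : Params) (ε : ℝ) : Mode → CDState → ℝ
  | .idle, _ => -ε / (1 - p.rho0)
  | .ic, .Kto => (1 - ε) / (1 - p.rho1)
  -- Solves the first-step equation at `U 0`; the other states matched here are never reached.
  | .ic, _ => (-ε + p.rho0 * p.Dp * ((1 - ε) / (1 - p.rho1))) / (1 - p.rho0 * (1 - p.Dp))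

/-- The relative future reward after a history of the mode controller. -/
noncomputable def modeBias (p : Params) (ε : ℝ) : List (Slot Mode) → ℝ
  | [] => 0
  | o :: h => if o.2.ack then 0 else o.1.bias p ε (stateOf ((o :: h).map Prod.snd))

/-- First-step analysis within a window, with value `0` at the ACK that ends it. `rho1 < 1` lets the
window end although IC keeps transmitting in `Kto`. -/
theorem Mode.bias_poisson (hth0 : 0 < th) (hth : th ≤ p.nablaGA) (hρ : p.rho1 < 1) (ε : ℝ)
    (m : Mode) {s : CDState} (hs : s = .U 0 ∨ s = .Kto) :
    act (m.action s) + (p.mean (m.action s) fun f =>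
      if f.ack then 0 else m.bias p ε (s.next f)) = ε + m.bias p ε s := by
  have hα := Params.rho0_mul_Dp_pos hth0 hth
  have h2 := p.rho0_lt_rho1
  have n0 : 1 - p.rho0 ≠ 0 := by linarith
  have n1 : 1 - p.rho1 ≠ 0 := by linarith
  have nA : 1 - p.rho0 * (1 - p.Dp) ≠ 0 := by linarith
  cases m with
  | idle =>
    simp only [Mode.action, Mode.bias, Params.mean_ack, act, Params.rho]
    simp
    field_simp
    ring
  | ic =>
    rcases hs with rfl | rfl
    · have e1 : (p.mean false fun f => if f.ack then 0 else
          Mode.ic.bias p ε ((CDState.U 0).next f)) = p.mean false fun f => if f.ack then 0 else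
            if f.y.puClear then Mode.ic.bias p ε .Kto else Mode.ic.bias p ε (.U 0) := by
        refine p.mean_congr fun f hf => ?_
        rw [CDState.next_U_zero_idle f hf]
        split_ifs <;> simp_all
      simp only [Mode.action, act, ne_eq, not_true, decide_false, e1, Params.mean_idle]
      simp only [Mode.bias]
      simp
      generalize (1 - ε) / (1 - p.rho1) = q
      field_simp
      ring
    · have e1 : (p.mean true fun f => if f.ack then 0 else
          Mode.ic.bias p ε (CDState.Kto.next f)) = p.mean true fun f => if f.ack then 0 else
            Mode.ic.bias p ε .Kto := by
        refine p.mean_congr fun f hf => ?_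
        rw [CDState.next_Kto]
        split_ifs <;> simp_all
      have e2 : Mode.ic.action .Kto = true := rfl
      rw [e2, e1, Params.mean_ack]
      simp [act, Mode.bias, Params.rho]
      field_simp
      ring

theorem isStochastic_modeController {ξ : ℝ} (h0 : 0 ≤ ξ) (h1 : ξ ≤ 1) :
    IsStochastic (modeController ξ) where
  nonneg h m a := by
    have h2 : 0 ≤ modeProb ξ h m := by
      cases h <;> cases m <;> simp only [modeProb] <;> (try split_ifs) <;> linarith
    unfold modeController
    split_ifs
    exacts [h2, le_rfl]
  sum_eq_one h := by
    have hM : (Finset.univ : Finset Mode) = {.idle, .ic} := by decide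
    have h2 : modeProb ξ h .idle + modeProb ξ h .ic = 1 := by
      rcases h with _ | ⟨⟨m, a, k, y⟩, h⟩
      · simp [modeProb]
      · cases k <;> cases m <;> simp [modeProb]
    rw [← h2, hM]
    simp [modeController]

/-- Renewal argument: relative to rate `ε`, an IC window gains `B` on average and an Idle window
loses `L`; `ξ` makes the mean gain per window zero. -/
theorem exists_modeController (hth0 : 0 < th) (hth : th ≤ p.nablaGA) (hρ : p.rho1 < 1) :
    ∃ ξ : ℝ, 0 ≤ ξ ∧ ξ ≤ 1 ∧ Tendsto (degAvg p (modeController ξ)) atTop (𝓝 th) ∧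
      Tendsto (thrAvg p (modeController ξ)) atTop (𝓝 (p.genie (th / p.nablaMax))) := by
  have hα := Params.rho0_mul_Dp_pos hth0 hth
  have hM := p.nablaMax_pos
  have hε : 0 < th / p.nablaMax := div_pos hth0 hM
  have hle := Params.div_nablaMax_le hth
  have h2 := p.rho0_lt_rho1
  rw [le_div_iff₀ (by linarith)] at hle
  set ε := th / p.nablaMax with hεdef
  have hthe : p.nablaMax * ε = th := mul_div_cancel₀ _ hM.ne'
  set B := Mode.ic.bias p ε (.U 0) with hBdef
  set L := ε / (1 - p.rho0) with hL
  have hL0 : 0 < L := div_pos hε (by linarith)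
  have hidleB : ∀ s, Mode.idle.bias p ε s = -L := fun s => by
    simp only [Mode.bias, hL]
    ring
  -- Feasibility again: after clearing denominators this is `hle`.
  have hB : 0 ≤ B := by
    rw [hBdef, Mode.bias]
    · refine div_nonneg ?_ (by linarith)
      rw [mul_div_assoc', neg_add_eq_sub, sub_nonneg, le_div_iff₀ (by linarith)]
      linarith
    · simp
  refine ⟨L / (B + L), by positivity, div_le_one_of_le₀ (by linarith) (by positivity), ?_⟩
  set ξ := L / (B + L) with hξ
  have hξ0 : 0 ≤ ξ := by positivity
  have hξ1 : ξ ≤ 1 := div_le_one_of_le₀ (by linarith) (by positivity)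
  have hbal : ξ * B + (1 - ξ) * -L = 0 := by
    rw [hξ]
    field_simp
    ring
  have := tendsto_degAvg_thrAvg (p := p) (g := ε) (W := modeBias p ε)
    (C := max (max L |B|) |Mode.ic.bias p ε .Kto|) (isStochastic_modeController hξ0 hξ1) ?_ ?_ ?_
  · rwa [hthe] at this
  · intro h m hs
    cases m <;> simp [modeController, hs, Mode.action]
  · have hC : ∀ m s, |Mode.bias p ε m s| ≤ max (max L |B|) |Mode.ic.bias p ε .Kto| := by
      intro m s
      cases m with
      | idle => simp [hidleB, abs_of_pos hL0]
      | ic =>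
        cases s with
        | Kto => simp
        | U b => exact (le_max_right L |B|).trans (le_max_left _ _)
        | Kbi => exact (le_max_right L |B|).trans (le_max_left _ _)
    intro h
    cases h with
    | nil => simp [modeBias]
    | cons o h =>
      simp only [modeBias]
      split_ifs
      · simp
      · exact hC _ _
  · intro h hs
    have hMu : (Finset.univ : Finset Mode) = {.idle, .ic} := by decide
    have hp := fun m => Mode.bias_poisson hth0 hth hρ ε m hs
    have h3 : ∀ m, ∑ a, modeController ξ h m a *
        (act a + p.mean a fun f => modeBias p ε ((m, f) :: h)) =
        modeProb ξ h m * (ε + m.bias p ε (stateOf (h.map Prod.snd))) := by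
      intro m
      rw [← hp m]
      simp only [modeController, ite_mul, zero_mul, Finset.sum_ite_eq',
        Finset.mem_univ, if_true]
      rfl
    simp only [h3, hMu]
    rw [Finset.sum_pair (by decide), hidleB]
    -- When a window begins, the modes are averaged and the balance `hbal` applies; after a NACK the
    -- mode is kept and only one term survives.
    have hfresh : (1 - ξ) * (ε + -L) + ξ * (ε + B) = ε + 0 := by linear_combination hbal
    rcases h with _ | ⟨⟨m, a, k, y⟩, h⟩
    · exact hfresh
    · cases k
      · cases m <;> simp [modeProb, modeBias, hidleB]
      · exact hfresh

end Feasible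

theorem theorem1 (p : Params) (th : ℝ) (hth0 : 0 < th) (hth1 : th < 1) (hth : th ≤ p.nablaGA) :
    -- the closed-form policy is optimal
    IsOptimalPolicy p th (stationary (muStar p th)) ∧
    -- it meets the constraint with equality and attains the genie-aided throughput
    Tendsto (degAvg p (ofPolicy (stationary (muStar p th)))) atTop (𝓝 th) ∧
    Tendsto (thrAvg p (ofPolicy (stationary (muStar p th)))) atTop
      (𝓝 (p.genie (th / p.nablaMax))) ∧
    -- the same performance is achieved by randomizing between the Idle and IC modes
    (p.rho1 < 1 → ∃ ξ : ℝ, 0 ≤ ξ ∧ ξ ≤ 1 ∧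
      Tendsto (degAvg p (modeController ξ)) atTop (𝓝 th) ∧
      Tendsto (thrAvg p (modeController ξ)) atTop (𝓝 (p.genie (th / p.nablaMax)))) := by
  have hμ := isAccessPolicy_muStar hth0 hth
  obtain ⟨hdeg, hthr⟩ := tendsto_muStar hth0 hth
  refine ⟨⟨hμ, hdeg.liminf_eq.le, fun ν hν hle => ?_⟩, hdeg, hthr, exists_modeController hth0 hth⟩
  exact (throughput_le_genie p (isStochastic_ofPolicy hν) hle).trans_eq hthr.liminf_eq.symm
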